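/- All algebras are over $\mathbb{C}$. A Leibniz algebra is a vector space $\mathcal{L}$ with a bilinear product $[\cdot,\cdot]$ satisfying $[x,[y,z]]=[[x,y],z]-[[x,z],y]$ for all $x,y,z$. Put $\mathcal{L}^1=\mathcal{L}$, $\mathcal{L}^{k+1}=[\mathcal{L}^k,\mathcal{L}]$; $\mathcal{L}$ is nilpotent if $\mathcal{L}^k=0$ for some $k$, and its associated naturally graded algebra is $\operatorname{gr}\mathcal{L}=\bigoplus_{i\ge 1}\mathcal{L}^i/\mathcal{L}^{i+1}$ with the induced product. A nilpotent $d$-dimensional Leibniz algebra is called $3$-filiform (where $d>3$) if the lexicographic maximum, over $x\in\mathcal{L}\setminus\mathcal{L}^2$, of the non-increasing sequence of Jordan block sizes of the nilpotent operator $R_x\colon y\mapsto [y,x]$ is $(d-3,1,1,1)$. A connected gradation of $\mathcal{L}$ is a decomposition $\mathcal{L}=\bigoplus_{i\in\mathbb{Z}}V_i$ with $[V_i,V_j]\subseteq V_{i+j}$ whose nonzero components are exactly $V_k,V_{k+1},\dots,V_{k+t}$ for some $k\in\mathbb{Z}$, $t\ge 0$; its length is $t+1$. The length $l(\mathcal{L})$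 is the maximum of the lengths of the connected gradations of $\mathcal{L}$. For $n\ge 6$ let $KF_5$ be the $n$-dimensional algebra with basis $e_1,\dots,e_n$ whose nonzero products of basis elements are $$[e_i,e_1]=e_{i+1}\ (1\le i\le n-3),\qquad [e_1,e_{n-1}]=e_2+e_n,\qquad [e_i,e_{n-1}]=e_{i+1}\ (2\le i\le n-3),$$ and let $KF_5\oplus\mathbb{C}$ be its direct sum with the one-dimensional algebra with zero product. **Theorem.** Let $n\ge 6$ and let $\mathcal{L}$ be an $(n+1)$-dimensional $3$-filiform Leibniz algebra which is not a Lie algebra and whose associated naturally graded algebra $\operatorname{gr}\mathcal{L}$ is isomorphic to $KF_5\oplus\mathbb{C}$. Then $l(\mathcal{L})\le n$; in particular $\mathcal{L}$ is not of maximum length. -/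

import Mathlib

namespace LeibnizLength

open Module

/-- Isomorphism of algebras. -/
def AlgIso {A B : Type*} [AddCommMonoid A] [Module ℂ A] [AddCommMonoid B] [Module ℂ B]
    (μ : A →ₗ[ℂ] A →ₗ[ℂ] A) (ν : B →ₗ[ℂ] B →ₗ[ℂ] B) : Prop :=
  ∃ e : A ≃ₗ[ℂ] B, ∀ x y, e (μ x y) = ν (e x) (e y)

section Algebras

variable {L : Type*} [AddCommGroup L] [Module ℂ L]

/-- An algebra structure on a complex vector space `L` is a bilinear product
`μ : L →ₗ[ℂ] L →ₗ[ℂ] L`, with `[x, y] = μ x y`.  It is a (right) Leibniz algebra if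
`[x, [y, z]] = [[x, y], z] - [[x, z], y]`. -/
def IsLeibniz (μ : L →ₗ[ℂ] L →ₗ[ℂ] L) : Prop :=
  ∀ x y z, μ x (μ y z) = μ (μ x y) z - μ (μ x z) y

/-- The product is that of a Lie algebra: alternating, with the Jacobi identity. -/
def IsLie (μ : L →ₗ[ℂ] L →ₗ[ℂ] L) : Prop :=
  (∀ x, μ x x = 0) ∧ ∀ x y z, μ x (μ y z) + μ y (μ z x) + μ z (μ x y) = 0

/-- The direct sum of two algebras, with componentwise product. -/
def sumBracket {L' : Type*} [AddCommGroup L'] [Module ℂ L']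
    (μ : L →ₗ[ℂ] L →ₗ[ℂ] L) (ν : L' →ₗ[ℂ] L' →ₗ[ℂ] L') :
    (L × L') →ₗ[ℂ] (L × L') →ₗ[ℂ] (L × L') :=
  LinearMap.mk₂ ℂ (fun p q => (μ p.1 q.1, ν p.2 q.2))
    (by intros; simp) (by intros; simp) (by intros; simp) (by intros; simp)

/-- The descending central sequence, indexed from `0`: `lcs μ k` is `L ^ (k + 1)`, where
`L ^ 1 = L` and `L ^ (k + 1) = [L ^ k, L]` (the linear span of the products). -/
def lcs (μ : L →ₗ[ℂ] L →ₗ[ℂ] L) : ℕ → Submodule ℂ L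
  | 0 => ⊤
  | k + 1 => Submodule.map₂ μ (lcs μ k) ⊤

/-- Nilpotency of the algebra. -/
def IsNilpotentAlg (μ : L →ₗ[ℂ] L →ₗ[ℂ] L) : Prop :=
  ∃ k, lcs μ k = ⊥

end Algebras

section NaturalGradation

variable {L : Type*} [AddCommGroup L] [Module ℂ L]

theorem lcs_succ_le (μ : L →ₗ[ℂ] L →ₗ[ℂ] L) (k : ℕ) : lcs μ (k + 1) ≤ lcs μ k := by
  induction k with
  | zero => exact le_top
  | succ k ih => exact Submodule.map₂_le_map₂_left ih

theorem mul_mem_lcs {μ : L →ₗ[ℂ] L →ₗ[ℂ] L} (h : IsLeibniz μ) (i j : ℕ) :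
    ∀ {x y : L}, x ∈ lcs μ i → y ∈ lcs μ j → μ x y ∈ lcs μ (i + j + 1) := by
  induction j generalizing i with
  | zero =>
    intro x y hx _
    exact Submodule.apply_mem_map₂ μ hx Submodule.mem_top
  | succ j ih =>
    intro x y hx hy
    have key : lcs μ (j + 1) ≤ (lcs μ (i + (j + 1) + 1)).comap (μ x) := by
      change Submodule.map₂ μ (lcs μ j) ⊤ ≤ _
      rw [Submodule.map₂_le]
      intro a ha b _
      rw [Submodule.mem_comap, h x a b]
      refine Submodule.sub_mem _ ?_ ?_
      · exact Submodule.apply_mem_map₂ μ (ih i hx ha) Submodule.mem_top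
      · have hxb : μ x b ∈ lcs μ (i + 1) :=
          Submodule.apply_mem_map₂ μ hx Submodule.mem_top
        have := ih (i + 1) hxb ha
        rwa [show i + 1 + j + 1 = i + (j + 1) + 1 by omega] at this
    exact key hy

/-- The homogeneous component `L ^ (i + 1) / L ^ (i + 2)` of the natural gradation. -/
abbrev GrPiece (μ : L →ₗ[ℂ] L →ₗ[ℂ] L) (i : ℕ) : Type _ :=
  (lcs μ i) ⧸ (lcs μ (i + 1)).submoduleOf (lcs μ i)

/-- The class in `L ^ (i + 1) / L ^ (i + 2)` of an element of `L ^ (i + 1)`. -/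
def grClass (μ : L →ₗ[ℂ] L →ₗ[ℂ] L) (i : ℕ) : lcs μ i →ₗ[ℂ] GrPiece μ i :=
  ((lcs μ (i + 1)).submoduleOf (lcs μ i)).mkQ

/-- `(x, y) ↦` the class of `[x, y]`, for `x ∈ L ^ (i + 1)` and `y ∈ L ^ (j + 1)`. -/
def preGrMul (μ : L →ₗ[ℂ] L →ₗ[ℂ] L) (h : IsLeibniz μ) (i j : ℕ) :
    lcs μ i →ₗ[ℂ] lcs μ j →ₗ[ℂ] GrPiece μ (i + j + 1) :=
  LinearMap.mk₂ ℂ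
    (fun x y => grClass μ (i + j + 1) ⟨μ x y, mul_mem_lcs h i j x.2 y.2⟩)
    (by intro x x' y; rw [← map_add]; congr 1; ext; simp)
    (by intro c x y; rw [← map_smul]; congr 1; ext; simp)
    (by intro x y y'; rw [← map_add]; congr 1; ext; simp)
    (by intro c x y; rw [← map_smul]; congr 1; ext; simp)

theorem preGrMul_eq_zero_right (μ : L →ₗ[ℂ] L →ₗ[ℂ] L) (h : IsLeibniz μ) (i j : ℕ)
    (x : lcs μ i) (y : lcs μ j) (hy : (y : L) ∈ lcs μ (j + 1)) :
    preGrMul μ h i j x y = 0 := by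
  refine (Submodule.Quotient.mk_eq_zero _).2 ?_
  exact mul_mem_lcs h i (j + 1) x.2 hy

theorem preGrMul_eq_zero_left (μ : L →ₗ[ℂ] L →ₗ[ℂ] L) (h : IsLeibniz μ) (i j : ℕ)
    (x : lcs μ i) (y : lcs μ j) (hx : (x : L) ∈ lcs μ (i + 1)) :
    preGrMul μ h i j x y = 0 := by
  refine (Submodule.Quotient.mk_eq_zero _).2 ?_
  have := mul_mem_lcs h (i + 1) j hx y.2
  rw [show i + 1 + j + 1 = i + j + 1 + 1 by omega] at this
  exact this

/-- The product of homogeneous components induced by the product of `L`. -/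
def grMul (μ : L →ₗ[ℂ] L →ₗ[ℂ] L) (h : IsLeibniz μ) (i j : ℕ) :
    GrPiece μ i →ₗ[ℂ] GrPiece μ j →ₗ[ℂ] GrPiece μ (i + j + 1) :=
  Submodule.liftQ _
    (LinearMap.flip (Submodule.liftQ _ (preGrMul μ h i j).flip
      (by
        intro y hy
        rw [LinearMap.mem_ker]
        ext x
        exact preGrMul_eq_zero_right μ h i j x y hy)))
    (by
      intro x hx
      rw [LinearMap.mem_ker]
      ext y
      exact preGrMul_eq_zero_left μ h i j x y hx)

open scoped DirectSum in
/-- The vector space of `gr L`, the direct sum of the `L ^ i / L ^ (i + 1)` for `i ≥ 1`. -/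
abbrev Gr (μ : L →ₗ[ℂ] L →ₗ[ℂ] L) : Type _ := ⨁ i : ℕ, GrPiece μ i

/-- The product of the associated naturally graded algebra `gr L`. -/
def grBracket (μ : L →ₗ[ℂ] L →ₗ[ℂ] L) (h : IsLeibniz μ) :
    Gr μ →ₗ[ℂ] Gr μ →ₗ[ℂ] Gr μ :=
  DirectSum.toModule ℂ ℕ _ fun i =>
    LinearMap.flip (DirectSum.toModule ℂ ℕ _ fun j =>
      LinearMap.flip ((grMul μ h i j).compr₂
        (DirectSum.lof ℂ ℕ (fun k => GrPiece μ k) (i + j + 1))))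

/-- The product of `gr L` on classes of homogeneous elements. -/
theorem grBracket_lof (μ : L →ₗ[ℂ] L →ₗ[ℂ] L) (h : IsLeibniz μ) (i j : ℕ)
    (x : lcs μ i) (y : lcs μ j) :
    grBracket μ h (DirectSum.lof ℂ ℕ (fun k => GrPiece μ k) i (grClass μ i x))
        (DirectSum.lof ℂ ℕ (fun k => GrPiece μ k) j (grClass μ j y)) =
      DirectSum.lof ℂ ℕ (fun k => GrPiece μ k) (i + j + 1)
        (grClass μ (i + j + 1) ⟨μ x y, mul_mem_lcs h i j x.2 y.2⟩) := by
  simp only [grBracket, DirectSum.toModule_lof, LinearMap.flip_apply, LinearMap.compr₂_apply]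
  rfl

end NaturalGradation

section CharacteristicSequence

variable {L : Type*} [AddCommGroup L] [Module ℂ L]

/-- `s` is the non-increasing sequence of the sizes of the Jordan blocks of the nilpotent
operator `f`: there is a basis made of strings `b₀ ↦ b₁ ↦ ⋯ ↦ b_(m-1) ↦ 0`, one of length `m`
for each entry `m` of `s`. -/
def IsJordanType (f : L →ₗ[ℂ] L) (s : List ℕ) : Prop :=
  s.Pairwise (· ≥ ·) ∧ (∀ m ∈ s, 0 < m) ∧
    ∃ b : Basis (Σ i : Fin s.length, Fin (s.get i)) ℂ L,
      ∀ (i : Fin s.length) (j : Fin (s.get i)),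
        f (b ⟨i, j⟩) = if h : (j : ℕ) + 1 < s.get i then b ⟨i, ⟨j + 1, h⟩⟩ else 0

/-- `s` is the characteristic sequence of the algebra: the maximum, for the lexicographic order
(the order of `List ℕ`), of the Jordan types of the nilpotent right multiplication operators
`y ↦ [y, x]` with `x ∈ L \ L ^ 2`. -/
def IsCharacteristicSequence (μ : L →ₗ[ℂ] L →ₗ[ℂ] L) (s : List ℕ) : Prop :=
  IsGreatest {s : List ℕ | ∃ x, x ∉ lcs μ 1 ∧ IsJordanType (μ.flip x) s} s

/-- A nilpotent algebra of dimension `d` is `p`-filiform (`p < d`) if its characteristic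
sequence is `(d - p, 1, …, 1)` with `p` ones. -/
def IsPFiliform (p : ℕ) (μ : L →ₗ[ℂ] L →ₗ[ℂ] L) : Prop :=
  IsNilpotentAlg μ ∧ p < finrank ℂ L ∧
    IsCharacteristicSequence μ ((finrank ℂ L - p) :: List.replicate p 1)

end CharacteristicSequence

section Length

variable {L : Type*} [AddCommGroup L] [Module ℂ L]

/-- `V` is a connected gradation `L = V_k ⊕ V_(k+1) ⊕ ⋯ ⊕ V_(k+t)` of the algebra: a
`ℤ`-gradation whose nonzero components are exactly those of index `k, …, k + t`. -/
structure IsConnectedGradation (μ : L →ₗ[ℂ] L →ₗ[ℂ] L) (V : ℤ → Submodule ℂ L)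
    (k : ℤ) (t : ℕ) : Prop where
  isInternal : DirectSum.IsInternal V
  mul_mem : ∀ i j : ℤ, ∀ x ∈ V i, ∀ y ∈ V j, μ x y ∈ V (i + j)
  ne_bot_iff : ∀ i : ℤ, V i ≠ ⊥ ↔ k ≤ i ∧ i ≤ k + t

/-- The lengths `t + 1` of the connected gradations of the algebra. -/
def gradationLengths (μ : L →ₗ[ℂ] L →ₗ[ℂ] L) : Set ℕ :=
  {l | ∃ (V : ℤ → Submodule ℂ L) (k : ℤ) (t : ℕ), IsConnectedGradation μ V k t ∧ l = t + 1}

/-- The length of an algebra: the maximum of the lengths of its connected gradations. -/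
noncomputable def algLength (μ : L →ₗ[ℂ] L →ₗ[ℂ] L) : ℕ := sSup (gradationLengths μ)

theorem gradationLengths_le_finrank [FiniteDimensional ℂ L] (μ : L →ₗ[ℂ] L →ₗ[ℂ] L)
    {l : ℕ} (hl : l ∈ gradationLengths μ) : l ≤ finrank ℂ L := by
  obtain ⟨V, k, t, hV, rfl⟩ := hl
  have hind : iSupIndep V := hV.isInternal.submodule_iSupIndep
  have hinj : Function.Injective (fun a : Fin (t + 1) => k + ((a : ℕ) : ℤ)) := by
    intro a b hab
    ext
    simpa using hab
  have hind' := hind.comp hinj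
  have hne : ∀ a : Fin (t + 1), (V ∘ fun a : Fin (t + 1) => k + ((a : ℕ) : ℤ)) a ≠ ⊥ := by
    intro a
    have := a.2
    refine (hV.ne_bot_iff _).2 ?_
    dsimp only
    constructor <;> omega
  have hfin := hind'.subtype_ne_bot_le_finrank
  have hcard : Fintype.card {a : Fin (t + 1) //
      (V ∘ fun a : Fin (t + 1) => k + ((a : ℕ) : ℤ)) a ≠ ⊥} = t + 1 := by
    rw [Fintype.card_congr (Equiv.subtypeUnivEquiv hne), Fintype.card_fin]
  omega

/-- For a nonzero finite-dimensional algebra the maximum in the definition of the length is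
attained. -/
theorem algLength_isGreatest [FiniteDimensional ℂ L] [Nontrivial L]
    (μ : L →ₗ[ℂ] L →ₗ[ℂ] L) : IsGreatest (gradationLengths μ) (algLength μ) := by
  have hbdd : BddAbove (gradationLengths μ) :=
    ⟨finrank ℂ L, fun _ hl => gradationLengths_le_finrank μ hl⟩
  have hne : (gradationLengths μ).Nonempty := by
    refine ⟨1, fun i => if i = 0 then ⊤ else ⊥, 0, 0, ⟨?_, ?_, ?_⟩, rfl⟩
    · rw [DirectSum.isInternal_submodule_iff_iSupIndep_and_iSup_eq_top]
      constructor
      · intro i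
        by_cases hi : i = 0
        · subst hi
          have : (⨆ j : ℤ, ⨆ _ : j ≠ 0, (if j = 0 then (⊤ : Submodule ℂ L) else ⊥)) = ⊥ := by
            simp only [iSup_eq_bot]
            intro j hj
            simp [hj]
          rw [this]
          exact disjoint_bot_right
        · simp [hi]
      · exact top_le_iff.1 (le_iSup_of_le (0 : ℤ) (by simp))
    · intro i j x hx y hy
      by_cases hi : i = 0
      · by_cases hj : j = 0
        · simp [hi, hj]
        · have : y = 0 := by simpa [hj] using hy
          simp [this]
      · have : x = 0 := by simpa [hi] using hx
        simp [this]
    · intro i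
      by_cases hi : i = 0
      · simp [hi]
      · simp only [hi, if_false, ne_eq, not_true_eq_false, false_iff]
        push_cast
        omega
  exact ⟨Nat.sSup_mem hne hbdd, fun _ hl => le_csSup hbdd hl⟩

end Length

section KF5

/-- The standard basis vectors `e_1, …, e_n` of `ℂ ^ n`, numbered from `1`
(and `0` for other indices). -/
def stdVec (n i : ℕ) : Fin n → ℂ := fun k => if (k : ℕ) + 1 = i then 1 else 0

/-- The product `[e_i, e_j]` in `KF₅`, the indices being numbered from `1`:
`[e_i, e_1] = e_(i+1)` for `1 ≤ i ≤ n - 3`, `[e_1, e_(n-1)] = e_2 + e_n`,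
`[e_i, e_(n-1)] = e_(i+1)` for `2 ≤ i ≤ n - 3`, and all others are zero. -/
def KF5Table (n i j : ℕ) : Fin n → ℂ :=
  if j = 1 ∧ 1 ≤ i ∧ i ≤ n - 3 then stdVec n (i + 1)
  else if j = n - 1 ∧ i = 1 then stdVec n 2 + stdVec n n
  else if j = n - 1 ∧ 2 ≤ i ∧ i ≤ n - 3 then stdVec n (i + 1)
  else 0

/-- The naturally graded `2`-filiform algebra `KF₅` of dimension `n`. -/
noncomputable def KF5 (n : ℕ) : (Fin n → ℂ) →ₗ[ℂ] (Fin n → ℂ) →ₗ[ℂ] (Fin n → ℂ) :=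
  (Pi.basisFun ℂ (Fin n)).constr ℂ fun i =>
    (Pi.basisFun ℂ (Fin n)).constr ℂ fun j => KF5Table n ((i : ℕ) + 1) ((j : ℕ) + 1)

/-- The algebra `KF₅ ⊕ ℂ`, where `ℂ` is the one-dimensional algebra with zero product. -/
noncomputable def KF5SumC (n : ℕ) :
    ((Fin n → ℂ) × ℂ) →ₗ[ℂ] ((Fin n → ℂ) × ℂ) →ₗ[ℂ] ((Fin n → ℂ) × ℂ) :=
  sumBracket (KF5 n) (0 : ℂ →ₗ[ℂ] ℂ →ₗ[ℂ] ℂ)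

end KF5

end LeibnizLength

namespace LeibnizLength

open Module

/-! ### Coordinates of products in the model algebra -/

section Coordinates

variable {n : ℕ}

/-! A connected gradation has length at most `dim L = n + 1`, so it suffices to exclude length `n +
1`, where every component is a line. Let `f` be the first coordinate and `φ` the sum of coordinates
`1` and `n - 1` in the model algebra, both read off on `L / L ^ 2`. Right multiplication by `y`
moves coordinates `1, …, n - 3` one place up, scaled by `φ y`. So if `f a` and `φ b` are nonzero,
`R_b^i a` is nonzero for `i ≤ n - 3`; moreover `[a, a] ∉ L ^ 3`. As `f` and `φ` are independent and
components are lines, `a` and `b` can be taken homogeneous of distinct degrees `s ≠ t`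
(`exists_homogeneous_pair`). A line containing a nonzero element of `L ^ m` lies in `L ^ m`, so the
lower central sequence keeps `t` and `2 s` apart and off the progression `s, s + t, …, s + (n - 3)
t`. These degrees do not fit in `n + 1` consecutive integers (`degrees_not_distinct`). -/

theorem KF5_apply_coord (X Y : Fin n → ℂ) (c : Fin n) :
    KF5 n X Y c = ∑ i : Fin n, ∑ j : Fin n,
      X i * (Y j * KF5Table n ((i : ℕ) + 1) ((j : ℕ) + 1) c) := by
  simp [KF5, Basis.constr_apply_fintype, LinearMap.sum_apply, Finset.sum_apply, Finset.mul_sum]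

/-- The sum of the first and the `(n - 1)`-st coordinates, on `ℂ ^ n`. -/
def outerSum (hn : 6 ≤ n) : (Fin n → ℂ) →ₗ[ℂ] ℂ :=
  LinearMap.proj ⟨0, by omega⟩ + LinearMap.proj ⟨n - 2, by omega⟩

theorem KF5Table_coord (hn : 6 ≤ n) (i j : Fin n) (m : ℕ) (hm : m + 1 < n - 2) :
    KF5Table n ((i : ℕ) + 1) ((j : ℕ) + 1) ⟨m + 1, by omega⟩ =
      if (i : ℕ) = m ∧ ((j : ℕ) = 0 ∨ (j : ℕ) = n - 2) then 1 else 0 := by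
  have hi := i.2
  have hj := j.2
  unfold KF5Table stdVec
  split_ifs <;> simp only [Pi.add_apply, Pi.zero_apply] <;> (try split_ifs) <;>
    first | omega | norm_num

/-- The coordinates of index `2, …, n - 2` of a product in `KF₅`. -/
theorem KF5_coord (hn : 6 ≤ n) (X Y : Fin n → ℂ) (m : ℕ) (hm : m + 1 < n - 2) :
    KF5 n X Y ⟨m + 1, by omega⟩ = X ⟨m, by omega⟩ * outerSum hn Y := by
  rw [KF5_apply_coord, Finset.sum_eq_single ⟨m, by omega⟩,
    Fintype.sum_eq_add (⟨0, by omega⟩ : Fin n) ⟨n - 2, by omega⟩]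
  · rw [KF5Table_coord hn _ _ m hm, KF5Table_coord hn _ _ m hm]
    simp [outerSum, mul_add]
  · simp only [ne_eq, Fin.mk.injEq]; omega
  · rintro j ⟨h1, h2⟩
    rw [KF5Table_coord hn _ _ m hm, if_neg]
    · simp
    · simp only [ne_eq, Fin.ext_iff] at h1 h2; simp [h1, h2]
  · intro i _ hi
    refine Finset.sum_eq_zero fun j _ => ?_
    rw [KF5Table_coord hn _ _ m hm, if_neg]
    · simp
    · simp only [ne_eq, Fin.ext_iff] at hi; simp [hi]
  · simp

theorem KF5Table_coord_last (hn : 6 ≤ n) (i j : Fin n) :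
    KF5Table n ((i : ℕ) + 1) ((j : ℕ) + 1) ⟨n - 1, by omega⟩ =
      if (i : ℕ) = 0 ∧ (j : ℕ) = n - 2 then 1 else 0 := by
  have hi := i.2
  have hj := j.2
  unfold KF5Table stdVec
  split_ifs <;> simp only [Pi.add_apply, Pi.zero_apply] <;> (try split_ifs) <;>
    first | omega | norm_num

/-- The last coordinate of a product in `KF₅`. -/
theorem KF5_coord_last (hn : 6 ≤ n) (X Y : Fin n → ℂ) :
    KF5 n X Y ⟨n - 1, by omega⟩ = X ⟨0, by omega⟩ * Y ⟨n - 2, by omega⟩ := by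
  rw [KF5_apply_coord, Finset.sum_eq_single ⟨0, by omega⟩,
    Finset.sum_eq_single (⟨n - 2, by omega⟩ : Fin n)]
  · rw [KF5Table_coord_last hn]
    simp
  · intro j _ hj
    rw [KF5Table_coord_last hn, if_neg]
    · simp
    · simp only [ne_eq, Fin.ext_iff] at hj; simp [hj]
  · simp
  · intro i _ hi
    refine Finset.sum_eq_zero fun j _ => ?_
    rw [KF5Table_coord_last hn, if_neg]
    · simp
    · simp only [ne_eq, Fin.ext_iff] at hi; simp [hi]
  · simp

theorem KF5Table_coord_generator (hn : 6 ≤ n) (i j c : Fin n)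
    (hc : (c : ℕ) = 0 ∨ (c : ℕ) = n - 2) :
    KF5Table n ((i : ℕ) + 1) ((j : ℕ) + 1) c = 0 := by
  unfold KF5Table stdVec
  split_ifs <;> simp only [Pi.add_apply, Pi.zero_apply] <;> (try split_ifs) <;>
    first | omega | norm_num

/-- Products in `KF₅` have no component along the generators. -/
theorem KF5_coord_generator (hn : 6 ≤ n) (X Y : Fin n → ℂ) (c : Fin n)
    (hc : (c : ℕ) = 0 ∨ (c : ℕ) = n - 2) : KF5 n X Y c = 0 := by
  simp [KF5_apply_coord, KF5Table_coord_generator hn _ _ c hc]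

/-- The first coordinate, on `KF₅ ⊕ ℂ`. -/
def firstCoord (hn : 6 ≤ n) : (Fin n → ℂ) × ℂ →ₗ[ℂ] ℂ :=
  LinearMap.proj ⟨0, by omega⟩ ∘ₗ LinearMap.fst ℂ _ _

/-- The sum of the first and the `(n - 1)`-st coordinates, on `KF₅ ⊕ ℂ`. -/
def outerCoord (hn : 6 ≤ n) : (Fin n → ℂ) × ℂ →ₗ[ℂ] ℂ :=
  outerSum hn ∘ₗ LinearMap.fst ℂ _ _

theorem KF5SumC_fst (X Y : (Fin n → ℂ) × ℂ) : (KF5SumC n X Y).1 = KF5 n X.1 Y.1 := rfl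

theorem firstCoord_mul (hn : 6 ≤ n) (X Y : (Fin n → ℂ) × ℂ) :
    firstCoord hn (KF5SumC n X Y) = 0 :=
  KF5_coord_generator hn _ _ _ (Or.inl rfl)

theorem outerCoord_mul (hn : 6 ≤ n) (X Y : (Fin n → ℂ) × ℂ) :
    outerCoord hn (KF5SumC n X Y) = 0 := by
  change KF5 n X.1 Y.1 _ + KF5 n X.1 Y.1 _ = 0
  rw [KF5_coord_generator hn _ _ _ (Or.inl rfl), KF5_coord_generator hn _ _ _ (Or.inr rfl),
    add_zero]

/-- The second and last coordinates of the square are `x₁ (x₁ + x_(n-1))` and `x₁ x_(n-1)`; if both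
vanish, so does `x₁`. -/
theorem KF5SumC_sq_ne_zero (hn : 6 ≤ n) {X : (Fin n → ℂ) × ℂ} (hX : firstCoord hn X ≠ 0) :
    KF5SumC n X X ≠ 0 := by
  intro h
  have h0 : KF5 n X.1 X.1 = 0 := by rw [← KF5SumC_fst, h]; rfl
  have h1 := KF5_coord hn X.1 X.1 0 (by omega)
  have h2 := KF5_coord_last hn X.1 X.1
  have hX' : X.1 ⟨0, by omega⟩ ≠ 0 := hX
  rw [h0, Pi.zero_apply, eq_comm, mul_eq_zero, or_iff_right hX'] at h1 h2
  have h3 : X.1 ⟨0, by omega⟩ + X.1 ⟨n - 2, by omega⟩ = 0 := h1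
  rw [h2, add_zero] at h3
  exact hX' h3

/-- Each multiplication by `Y` is a shift scaled by `outerCoord Y`, so the first coordinate is
carried along the chain. -/
theorem KF5SumC_iterate_coord (hn : 6 ≤ n) (X Y : (Fin n → ℂ) × ℂ) (m : ℕ) (hm : m < n - 2) :
    (((KF5SumC n).flip Y)^[m] X).1 ⟨m, by omega⟩ = firstCoord hn X * outerCoord hn Y ^ m := by
  induction m with
  | zero => simp [firstCoord]
  | succ m ih =>
    rw [Function.iterate_succ_apply', LinearMap.flip_apply, KF5SumC_fst,
      KF5_coord hn _ _ m hm, ih (by omega), pow_succ, mul_assoc]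
    rfl

theorem KF5SumC_iterate_ne_zero (hn : 6 ≤ n) {X Y : (Fin n → ℂ) × ℂ}
    (hX : firstCoord hn X ≠ 0) (hY : outerCoord hn Y ≠ 0) (m : ℕ) (hm : m < n - 2) :
    ((KF5SumC n).flip Y)^[m] X ≠ 0 := by
  intro h
  have := KF5SumC_iterate_coord hn X Y m hm
  rw [h] at this
  exact mul_ne_zero hX (pow_ne_zero m hY) this.symm

/-- The two functionals are linearly independent. -/
theorem coord_independent (hn : 6 ≤ n) {α β : ℂ}
    (h : α • firstCoord hn + β • outerCoord hn = 0) : α = 0 ∧ β = 0 := by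
  have h1 := LinearMap.congr_fun h (Pi.single ⟨0, by omega⟩ 1, 0)
  have h2 := LinearMap.congr_fun h (Pi.single ⟨n - 2, by omega⟩ 1, 0)
  have e1 : (0 : ℕ) ≠ n - 2 := by omega
  have e2 : n - 2 ≠ (0 : ℕ) := by omega
  simp [firstCoord, outerCoord, outerSum, e1, e2] at h1 h2
  simp_all

end Coordinates

/-! ### Passing from `gr L` to `L` -/

section Graded

variable {L : Type*} [AddCommGroup L] [Module ℂ L] (μ : L →ₗ[ℂ] L →ₗ[ℂ] L) (h : IsLeibniz μ)

/-- The symbol in degree `i` of an element of `L ^ (i + 1)`. -/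
def symbol (i : ℕ) : lcs μ i →ₗ[ℂ] Gr μ :=
  DirectSum.lof ℂ ℕ (fun k => GrPiece μ k) i ∘ₗ grClass μ i

/-- The class of an element of `L` in `L / L ^ 2`, seen in `gr L`. -/
def leading : L →ₗ[ℂ] Gr μ :=
  symbol μ 0 ∘ₗ LinearMap.codRestrict (lcs μ 0) LinearMap.id fun _ => Submodule.mem_top

variable {μ}

theorem symbol_eq_zero {i : ℕ} (x : lcs μ i) (hx : (x : L) ∈ lcs μ (i + 1)) :
    symbol μ i x = 0 := by
  have : grClass μ i x = 0 := (Submodule.Quotient.mk_eq_zero _).2 hx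
  rw [symbol, LinearMap.comp_apply, this, map_zero]

theorem leading_eq_zero {x : L} (hx : x ∈ lcs μ 1) : leading μ x = 0 :=
  symbol_eq_zero _ hx

theorem mul_leading {i : ℕ} (x : lcs μ i) (y : L) :
    grBracket μ h (symbol μ i x) (leading μ y) =
      symbol μ (i + 1) ⟨μ x y, mul_mem_lcs h i 0 x.2 Submodule.mem_top⟩ :=
  grBracket_lof μ h i 0 x ⟨y, Submodule.mem_top⟩

theorem iterate_mem_lcs (x y : L) (m : ℕ) : (μ.flip y)^[m] x ∈ lcs μ m := by
  induction m with
  | zero => exact Submodule.mem_top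
  | succ m ih =>
    rw [Function.iterate_succ_apply']
    exact Submodule.apply_mem_map₂ μ ih Submodule.mem_top

/-- Lets nonvanishing in `gr L` be pulled back: if the iterate in `L` were zero, so would be its
symbol. -/
theorem iterate_leading (x y : L) (m : ℕ) :
    ((grBracket μ h).flip (leading μ y))^[m] (leading μ x) =
      symbol μ m ⟨(μ.flip y)^[m] x, iterate_mem_lcs x y m⟩ := by
  induction m with
  | zero => rfl
  | succ m ih =>
    rw [Function.iterate_succ_apply', ih, LinearMap.flip_apply, mul_leading]
    congr 1
    ext
    simp [Function.iterate_succ_apply']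

/-- `gr L` is generated in degree one: a functional which vanishes on products and on the
component of degree one is zero. -/
theorem functional_eq_zero (ψ : Gr μ →ₗ[ℂ] ℂ) (hmul : ∀ x y, ψ (grBracket μ h x y) = 0)
    (hlead : ∀ x, ψ (leading μ x) = 0) : ψ = 0 := by
  refine DirectSum.linearMap_ext _ fun i => ?_
  refine LinearMap.ext fun z => ?_
  obtain ⟨x, rfl⟩ := Submodule.Quotient.mk_surjective _ z
  change ψ (symbol μ i x) = 0
  cases i with
  | zero => exact hlead x
  | succ i =>
    obtain ⟨x, hx⟩ := x
    -- `symbol` lives on a subtype, so its vanishing is phrased in `L` through the image of a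
    -- kernel; then checking products suffices.
    have key : lcs μ (i + 1) ≤
        (LinearMap.ker (ψ ∘ₗ symbol μ (i + 1))).map (lcs μ (i + 1)).subtype := by
      refine Submodule.map₂_le.2 fun u hu y _ =>
        ⟨⟨μ u y, mul_mem_lcs h i 0 hu Submodule.mem_top⟩, ?_, rfl⟩
      exact (congrArg ψ (mul_leading h ⟨u, hu⟩ y)).symm.trans (hmul _ _)
    obtain ⟨x', hx', rfl⟩ := key hx
    exact hx'

/-- Two functionals on `L` which record the structure of `gr L ≅ KF₅ ⊕ ℂ` needed below. -/
theorem exists_functionals {n : ℕ} (hn : 6 ≤ n)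
    (hgr : AlgIso (grBracket μ h) (KF5SumC n)) :
    ∃ f φ : L →ₗ[ℂ] ℂ, (∀ x ∈ lcs μ 1, f x = 0) ∧ (∀ x ∈ lcs μ 1, φ x = 0) ∧
      (∀ α β : ℂ, α • f + β • φ = 0 → α = 0 ∧ β = 0) ∧
      (∀ x, f x ≠ 0 → μ x x ∉ lcs μ 2) ∧
      ∀ x y, f x ≠ 0 → φ y ≠ 0 → ∀ m < n - 2, (μ.flip y)^[m] x ≠ 0 := by
  obtain ⟨e, he⟩ := hgr
  refine ⟨firstCoord hn ∘ₗ e.toLinearMap ∘ₗ leading μ,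
    outerCoord hn ∘ₗ e.toLinearMap ∘ₗ leading μ, ?_, ?_, ?_, ?_, ?_⟩
  · intro x hx
    simp [leading_eq_zero hx]
  · intro x hx
    simp [leading_eq_zero hx]
  · intro α β hαβ
    apply coord_independent hn
    have h0 : (α • firstCoord hn + β • outerCoord hn) ∘ₗ e.toLinearMap = 0 := by
      -- A relation on `L` only controls degree one; generation of `gr L` in degree one extends it
      -- to all of `gr L`.
      refine functional_eq_zero h _ (fun x y => ?_) fun x => LinearMap.congr_fun hαβ x
      simp [he, firstCoord_mul, outerCoord_mul]
    refine LinearMap.ext fun X => ?_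
    simpa using LinearMap.congr_fun h0 (e.symm X)
  · intro x hx hsq
    refine KF5SumC_sq_ne_zero hn hx ?_
    change KF5SumC n (e (leading μ x)) (e (leading μ x)) = 0
    rw [← he, show grBracket μ h (leading μ x) (leading μ x) = 0 from
      (mul_leading h ⟨x, Submodule.mem_top⟩ x).trans (symbol_eq_zero _ hsq), map_zero]
  · intro x y hx hy m hm hzero
    refine KF5SumC_iterate_ne_zero hn hx hy m hm ?_
    have hcomm : ∀ m, ((KF5SumC n).flip (e (leading μ y)))^[m] (e (leading μ x)) =
        e (((grBracket μ h).flip (leading μ y))^[m] (leading μ x)) := by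
      intro m
      induction m with
      | zero => rfl
      | succ m ih => simp [Function.iterate_succ_apply', ih, he]
    refine (hcomm m).trans ?_
    rw [iterate_leading, symbol_eq_zero, map_zero]
    simp [hzero]

end Graded

/-! ### Gradations with one-dimensional components -/

section Length

variable {L : Type*} [AddCommGroup L] [Module ℂ L] {μ : L →ₗ[ℂ] L →ₗ[ℂ] L}

/-- In a connected gradation of length `dim L` all components are at most one-dimensional. -/
theorem IsConnectedGradation.finrank_le_one {V : ℤ → Submodule ℂ L} {k : ℤ} {t : ℕ}
    (hV : IsConnectedGradation μ V k t) (hdim : finrank ℂ L = t + 1) (i : ℤ) :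
    finrank ℂ (V i) ≤ 1 := by
  have : FiniteDimensional ℂ L := Module.finite_of_finrank_pos (by omega)
  by_cases hi : V i = ⊥
  · rw [hi, finrank_bot]
    exact zero_le_one
  obtain ⟨h1, h2⟩ := (hV.ne_bot_iff i).1 hi
  have hinj : Function.Injective (fun a : Fin (t + 1) => k + ((a : ℕ) : ℤ)) := by
    intro a b hab
    ext
    simpa using hab
  have hind := hV.isInternal.submodule_iSupIndep.comp hinj
  have htop : ⨆ a : Fin (t + 1), V (k + ((a : ℕ) : ℤ)) = ⊤ := by
    rw [eq_top_iff, ← hV.isInternal.submodule_iSup_eq_top]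
    refine iSup_le fun j => ?_
    by_cases hj : V j = ⊥
    · simp [hj]
    obtain ⟨j1, j2⟩ := (hV.ne_bot_iff j).1 hj
    refine le_iSup_of_le (⟨(j - k).toNat, by omega⟩ : Fin (t + 1)) (le_of_eq ?_)
    congr 1
    simp only
    omega
  have hint : DirectSum.IsInternal fun a : Fin (t + 1) => V (k + ((a : ℕ) : ℤ)) :=
    (DirectSum.isInternal_submodule_iff_iSupIndep_and_iSup_eq_top _).2 ⟨hind, htop⟩
  have hsum : finrank ℂ L = ∑ a : Fin (t + 1), finrank ℂ (V (k + ((a : ℕ) : ℤ))) := by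
    rw [← (LinearEquiv.ofBijective (DirectSum.coeLinearMap _) hint).finrank_eq,
      Module.finrank_directSum]
  have hpos : ∀ a : Fin (t + 1), 1 ≤ finrank ℂ (V (k + ((a : ℕ) : ℤ))) := fun a => by
    have ha := a.2
    exact Submodule.one_le_finrank_iff.2 ((hV.ne_bot_iff _).2 (by omega))
  by_contra! hlt
  have : ∑ _a : Fin (t + 1), 1 < ∑ a : Fin (t + 1), finrank ℂ (V (k + ((a : ℕ) : ℤ))) := by
    refine Finset.sum_lt_sum (fun a _ => hpos a)
      ⟨⟨(i - k).toNat, by omega⟩, Finset.mem_univ _, ?_⟩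
    rwa [show k + (((⟨(i - k).toNat, by omega⟩ : Fin (t + 1)) : ℕ) : ℤ) = i by
      simp only; omega]
  rw [← hsum, hdim] at this
  simp at this

/-- A subspace meeting a subspace of dimension at most one nontrivially contains it. -/
theorem le_of_finrank_le_one {W S : Submodule ℂ L} [FiniteDimensional ℂ L]
    (hW : finrank ℂ W ≤ 1) {v : L} (hv : v ∈ W) (hvS : v ∈ S) (hv0 : v ≠ 0) : W ≤ S := by
  have hW1 : finrank ℂ W = 1 := le_antisymm hW
    (Submodule.one_le_finrank_iff.2 fun hb => hv0 (by simpa [hb] using hv))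
  intro u hu
  obtain ⟨c, hc⟩ := (finrank_eq_one_iff_of_nonzero' (⟨v, hv⟩ : W) (by simpa using hv0)).1 hW1 ⟨u, hu⟩
  have : c • v = u := congrArg Subtype.val hc
  exact this ▸ S.smul_mem c hvS

/-- Two independent functionals do not vanish on homogeneous elements of distinct degrees. -/
theorem exists_homogeneous_pair [FiniteDimensional ℂ L] {V : ℤ → Submodule ℂ L}
    (htop : ⨆ i, V i = ⊤) (hone : ∀ i, finrank ℂ (V i) ≤ 1) {f φ : L →ₗ[ℂ] ℂ}
    (hind : ∀ α β : ℂ, α • f + β • φ = 0 → α = 0 ∧ β = 0) :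
    ∃ s t, s ≠ t ∧ ∃ a ∈ V s, ∃ b ∈ V t, f a ≠ 0 ∧ φ b ≠ 0 := by
  have ext0 : ∀ ψ : L →ₗ[ℂ] ℂ, (∀ i, ∀ x ∈ V i, ψ x = 0) → ψ = 0 := by
    intro ψ hψ
    rw [← LinearMap.ker_eq_top, eq_top_iff, ← htop]
    exact iSup_le hψ
  by_contra! hno
  obtain ⟨s, a, ha, hfa⟩ : ∃ s, ∃ a ∈ V s, f a ≠ 0 := by
    by_contra! hf
    have := (hind 1 0 (by simp [ext0 f hf])).1
    simp at this
  obtain ⟨t, b, hb, hφb⟩ : ∃ t, ∃ b ∈ V t, φ b ≠ 0 := by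
    by_contra! hf
    have := (hind 0 1 (by simp [ext0 φ hf])).2
    simp at this
  obtain rfl : s = t := by
    by_contra hst
    exact hφb (hno s t hst a ha b hb hfa)
  -- The coefficients make the combination vanish at `a`, hence on the line `V s`; in other degrees
  -- `f` and `φ` both vanish.
  have hker : φ a • f + (-f a) • φ = 0 := by
    refine ext0 _ fun i x hx => ?_
    by_cases his : i = s
    · subst his
      refine le_of_finrank_le_one (S := LinearMap.ker (φ a • f + (-f a) • φ)) (hone i) ha ?_ ?_ hx
      · simp [mul_comm]
      · rintro rfl
        simp at hfa
    · have h1 : φ x = 0 := hno s i (Ne.symm his) a ha x hx hfa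
      have h2 : f x = 0 := by
        by_contra hfx
        exact hφb (hno i s his x hx b hb hfx)
      simp [h1, h2]
  exact hfa (neg_eq_zero.1 (hind _ _ hker).2)

/-- The degrees `s`, `t`, `2 s`, `s + t`, `s + 2 t`, …, `s + (n - 3) t` cannot be distinct
elements of an interval of `n + 1` integers. -/
theorem degrees_not_distinct {n : ℕ} (hn : 6 ≤ n) {k s t : ℤ} (ht : k ≤ t ∧ t ≤ k + n)
    (h2s : k ≤ 2 * s ∧ 2 * s ≤ k + n)
    (hst : ∀ i : ℕ, i < n - 2 → k ≤ s + i * t ∧ s + i * t ≤ k + n)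
    (ht0 : t ≠ 0) (hs0 : s ≠ 0) (h2st : 2 * s ≠ t)
    (hts : ∀ i : ℕ, i < n - 2 → t ≠ s + i * t)
    (h2si : ∀ i : ℕ, i < n - 2 → 2 * s ≠ s + i * t) : False := by
  have hlast := hst (n - 3) (by omega)
  have hfirst := hst 0 (by omega)
  rw [Nat.cast_sub (by omega)] at hlast
  push_cast at hlast hfirst
  have hn' : (6 : ℤ) ≤ n := by exact_mod_cast hn
  -- The progression spans `(n - 3) |t| ≤ n`, which excludes `|t| ≥ 3`.
  have hup : t ≤ 2 := by
    by_contra! hlt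
    nlinarith
  have hlow : -2 ≤ t := by
    by_contra! hlt
    nlinarith
  obtain rfl | rfl | rfl | rfl : t = 1 ∨ t = -1 ∨ t = 2 ∨ t = -2 := by omega
  -- The progression is the whole interval `[s, s + n - 3]`. As `1` and `2 s` avoid it and `s ≠ 0`,
  -- either `s ≥ n - 2` or `s ≤ 3 - n`; then `|2 s - 1| ≥ 2 n - 5 > n`.
  · have e1 := hts (1 - s).toNat
    have e2 := h2si s.toNat
    omega
  · have e1 := hts (s + 1).toNat
    have e2 := h2si (-s).toNat
    omega
  · obtain rfl : n = 6 := by omega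
    have e1 := hts 0
    have e2 := hts 1
    have e3 := hts 2
    have e4 := hts 3
    have f1 := h2si 0
    have f2 := h2si 1
    have f3 := h2si 2
    have f4 := h2si 3
    omega
  · obtain rfl : n = 6 := by omega
    have e1 := hts 0
    have e2 := hts 1
    have e3 := hts 2
    have e4 := hts 3
    have f1 := h2si 0
    have f2 := h2si 1
    have f3 := h2si 2
    have f4 := h2si 3
    omega

theorem lcs_antitone (μ : L →ₗ[ℂ] L →ₗ[ℂ] L) : Antitone (lcs μ) :=
  antitone_nat_of_succ_le (lcs_succ_le μ)

/-- An algebra whose naturally graded algebra is `KF₅ ⊕ ℂ` is not of maximum length. -/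
theorem not_isConnectedGradation {n : ℕ} (hn : 6 ≤ n) (h : IsLeibniz μ)
    (hdim : finrank ℂ L = n + 1) (hgr : AlgIso (grBracket μ h) (KF5SumC n))
    (V : ℤ → Submodule ℂ L) (k : ℤ) : ¬ IsConnectedGradation μ V k n := by
  intro hV
  have : FiniteDimensional ℂ L := Module.finite_of_finrank_pos (by omega)
  obtain ⟨f, φ, hf, hφ, hind, hsq, hiter⟩ := exists_functionals h hn hgr
  have hone := hV.finrank_le_one hdim
  obtain ⟨s, t, hst, a, ha, b, hb, hfa, hφb⟩ :=
    exists_homogeneous_pair hV.isInternal.submodule_iSup_eq_top hone hind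
  have hrange : ∀ {i : ℤ} {x : L}, x ∈ V i → x ≠ 0 → k ≤ i ∧ i ≤ k + n := by
    intro i x hx hx0
    exact (hV.ne_bot_iff i).1 fun hb => hx0 (by simpa [hb] using hx)
  -- Equal degrees would put `x` on the line of `y`, hence in the same term of the lower central
  -- sequence.
  have hdist : ∀ {m : ℕ} {i j : ℤ} {x y : L}, x ∈ V i → y ∈ V j → y ∈ lcs μ m → y ≠ 0 →
      x ∉ lcs μ m → i ≠ j := by
    rintro m i j x y hx hy hym hy0 hxm rfl
    exact hxm (le_of_finrank_le_one (hone i) hy hym hy0 hx)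
  have ha1 : a ∉ lcs μ 1 := fun hm => hfa (hf a hm)
  have hb1 : b ∉ lcs μ 1 := fun hm => hφb (hφ b hm)
  have hb0 : b ≠ 0 := fun h0 => hφb (by rw [h0, map_zero])
  have haa : μ a a ∈ V (2 * s) := by
    rw [two_mul]
    exact hV.mul_mem s s a ha a ha
  have haa1 : μ a a ∈ lcs μ 1 := Submodule.apply_mem_map₂ μ Submodule.mem_top Submodule.mem_top
  have haa2 : μ a a ∉ lcs μ 2 := hsq a hfa
  have haa0 : μ a a ≠ 0 := fun h0 => haa2 (h0 ▸ Submodule.zero_mem _)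
  have hmem : ∀ i : ℕ, (μ.flip b)^[i] a ∈ V (s + i * t) := by
    intro i
    induction i with
    | zero => simpa using ha
    | succ i ih =>
      rw [Function.iterate_succ_apply',
        show s + ((i + 1 : ℕ) : ℤ) * t = s + i * t + t by push_cast; ring]
      exact hV.mul_mem _ _ _ ih _ hb
  have hne := hiter a b hfa hφb
  have hlcs : ∀ i m : ℕ, m ≤ i → (μ.flip b)^[i] a ∈ lcs μ m :=
    fun i m hmi => lcs_antitone μ hmi (iterate_mem_lcs a b i)
  have ht0 : t ≠ 0 := by
    have := hdist ha (hmem 1) (hlcs 1 1 le_rfl) (hne 1 (by omega)) ha1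
    intro h0
    simp [h0] at this
  have hs0 : s ≠ 0 := by
    have := hdist ha haa haa1 haa0 ha1
    intro h0
    simp [h0] at this
  refine degrees_not_distinct hn (hrange hb hb0) (hrange haa haa0)
    (fun i hi => hrange (hmem i) (hne i hi)) ht0 hs0
    (hdist hb haa haa1 haa0 hb1).symm (fun i hi => ?_) fun i hi => ?_
  · rcases Nat.eq_zero_or_pos i with rfl | hi0
    · simpa using hst.symm
    · exact hdist hb (hmem i) (hlcs i 1 hi0) (hne i hi) hb1
  -- For `i = 0, 1` this is `s ≠ 0` and `s ≠ t`; from `i = 2` on the iterate is in `L ^ 3`, which is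
  -- `lcs μ 2`, but `[a, a]` is not.
  · rcases Nat.lt_or_ge i 2 with hi2 | hi2
    · interval_cases i
      · push_cast; omega
      · push_cast; omega
    · exact hdist haa (hmem i) (hlcs i 2 hi2) (hne i hi) haa2

end Length

end LeibnizLength

theorem mainTheorem3 (n : ℕ) (hn : 6 ≤ n) {L : Type*} [AddCommGroup L] [Module ℂ L]
    (μ : L →ₗ[ℂ] L →ₗ[ℂ] L) (hLeib : LeibnizLength.IsLeibniz μ)
    (hdim : Module.finrank ℂ L = n + 1)
    (hfil : LeibnizLength.IsPFiliform 3 μ)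
    (hnonLie : ¬ LeibnizLength.IsLie μ)
    (hgr : LeibnizLength.AlgIso (LeibnizLength.grBracket μ hLeib) (LeibnizLength.KF5SumC n)) :
    LeibnizLength.algLength μ ≤ n := by
  have : FiniteDimensional ℂ L := Module.finite_of_finrank_pos (by omega)
  have : Nontrivial L := Module.nontrivial_of_finrank_pos (R := ℂ) (by omega)
  have hmem := (LeibnizLength.algLength_isGreatest μ).1
  have hle := LeibnizLength.gradationLengths_le_finrank μ hmem
  obtain ⟨V, k, t, hV, hl⟩ := hmem
  by_contra! hlt
  obtain rfl : t = n := by omega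
  exact LeibnizLength.not_isConnectedGradation hn hLeib hdim hgr V k hV
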